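/- Let $k\ge 1$ be an integer and let $\alpha,\beta$ be real numbers with $\alpha\ge\beta>-1$. Let $P_k^{(\alpha,\beta)}$ be the Jacobi polynomial of degree $k$, i.e. the polynomial of degree $k$ (unique up to a nonzero constant factor, which does not affect its zeros) that is orthogonal on $[-1,1]$, with respect to the weight $(1-x)^{\alpha}(1+x)^{\beta}$, to all polynomials of degree less than $k$. Put $$s=\alpha+\beta+1,\qquad q=\alpha-\beta,\qquad r=2k+\alpha+\beta+1,\qquad R=\sqrt{(r^2-q^2+2s+1)(r^2-s^2)},$$ $$y_1=-\frac{R+q(s+1)}{r^2+2s+1},\qquad y_2=\frac{R-q(s+1)}{r^2+2s+1}.$$ Then $P_k^{(\alpha,\beta)}$ has a least real zero $x_m$ and a largest real zero $x_M$, and $$x_m>y_1+3\,(1-y_1^2)^{2/3}\,(2R)^{-1/3},$$ $$x_M<y_2-3\,(1-y_2^2)^{2/3}\,(2R)^{-1/3}+\frac{4q(s+1)}{(r^2+2s+1)^{3/2}}.$$ -/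

import Mathlib

/-- The Jacobi weight `(1 - x) ^ α * (1 + x) ^ β` (used on the interval `[-1, 1]`). -/
noncomputable def jacobiWeight (α β x : ℝ) : ℝ :=
  (1 - x) ^ α * (1 + x) ^ β

/-- `P` is a Jacobi polynomial of degree `k` with parameters `α, β > -1`: it has degree exactly `k`
and is orthogonal on `[-1, 1]`, with respect to the Jacobi weight, to every polynomial of smaller
degree. This determines `P` up to a nonzero constant factor, which does not affect its zeros; no
normalization is imposed. -/
structure IsJacobiPolynomial (α β : ℝ) (k : ℕ) (P : Polynomial ℝ) : Prop where
  degree_eq : P.degree = (k : WithBot ℕ)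
  orthogonal : ∀ Q : Polynomial ℝ, Q.degree < (k : WithBot ℕ) →
    ∫ x in (-1 : ℝ)..1, P.eval x * Q.eval x * jacobiWeight α β x = 0

/-! Orthogonality gives `P` simple zeros, all in `(-1, 1)`, and the equation `w P'' - g P' + l P =
0` with `w = 1 - x^2`, `g = σ x + q`, `σ = s + 1`, `4 l = r^2 - s^2`. Write `P = (x - z) Q` up to a
constant factor, with `z` the largest zero. Laguerre's inequality for the real-rooted `Q`, with
`P''` eliminated by the equation, says `t^2 - (g t - l) / w ≥ 1 / (x - z)^2` for `t = P' / P`. The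
left side is least at `t = g / (2 w)`, a value attained at some `x` in `(z, 1)`; this is
`exists_discriminant_ge_of_jacobi_equation`.

There the discriminant `4 l w - g^2` equals `D u v`, with `D = r^2 + 2 s + 1`, `u = y₂ - x`, `v = x
- y₁`. Hence `y₂ - z = u + (x - z) ≥ u + 2 w / √(D u v)`. Up to the error term, the fraction is at
least `2 (1 - y₂^2) / √(2 R u)`, and minimizing over `u` by AM-GM yields the cube-root term
(`lt_turning_point_sub`).

The error is present only when `q σ > 0`. The least zero follows by the reflection `x ↦ -x`, which
replaces `q` by `-q ≤ 0`, so its bound has no correction. -/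

/-! ### Laguerre's inequality and the differential equation -/

open Polynomial in
/-- Laguerre's inequality for products of real linear factors. -/
theorem laguerre_prod_X_sub_C (Z : Finset ℝ) (x : ℝ) :
    0 ≤ (derivative (∏ z ∈ Z, (X - C z))).eval x ^ 2
      - (∏ z ∈ Z, (X - C z)).eval x * (derivative (derivative (∏ z ∈ Z, (X - C z)))).eval x := by
  classical
  induction Z using Finset.induction_on with
  | empty => simp
  | insert a Z ha ih =>
    rw [Finset.prod_insert ha]
    set Q : ℝ[X] := ∏ z ∈ Z, (X - C z)
    simp only [derivative_mul, derivative_add, derivative_sub, derivative_X, derivative_C,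
      eval_add, eval_mul, eval_sub, eval_X, eval_C, sub_zero, one_mul]
    nlinarith [mul_nonneg (sq_nonneg (x - a)) ih, sq_nonneg (Q.eval x)]

open Polynomial in
theorem eval_prod_X_sub_C_pos {Z : Finset ℝ} {x : ℝ} (h : ∀ z ∈ Z, z < x) :
    0 < (∏ z ∈ Z, (X - C z)).eval x := by
  rw [eval_prod]
  exact Finset.prod_pos fun z hz => by simpa using h z hz

open Polynomial in
/-- To the right of the largest zero of a real-rooted solution of the Jacobi equation there is a
point at which the discriminant of the equation dominates the squared inverse distance. -/
theorem exists_discriminant_ge_of_jacobi_equation {σ q l y : ℝ} {Z : Finset ℝ} (hσq : 0 < σ + q)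
    (hy : -1 < y) (hy1 : y < 1) (hZ : ∀ z ∈ Z, z < y)
    (hode : ∀ x : ℝ, (1 - x ^ 2) *
        (derivative (derivative ((X - C y) * ∏ z ∈ Z, (X - C z)))).eval x
      - (σ * x + q) * (derivative ((X - C y) * ∏ z ∈ Z, (X - C z))).eval x
      + l * ((X - C y) * ∏ z ∈ Z, (X - C z)).eval x = 0) :
    ∃ x, y < x ∧ x < 1 ∧
      4 * (1 - x ^ 2) ^ 2 ≤ (x - y) ^ 2 * (4 * l * (1 - x ^ 2) - (σ * x + q) ^ 2) := by
  have lag := laguerre_prod_X_sub_C Z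
  have pos : ∀ x, y ≤ x → 0 < (∏ z ∈ Z, (X - C z)).eval x := fun x hx =>
    eval_prod_X_sub_C_pos fun z hz => (hZ z hz).trans_le hx
  set Q : ℝ[X] := ∏ z ∈ Z, (X - C z)
  set P : ℝ[X] := (X - C y) * Q with hP
  have hP0 : ∀ x, P.eval x = (x - y) * Q.eval x := fun x => by simp [hP]
  have hP1 : ∀ x, (derivative P).eval x = Q.eval x + (x - y) * (derivative Q).eval x :=
    fun x => by simp [hP]
  have hP2 : ∀ x, (derivative (derivative P)).eval x =
      2 * (derivative Q).eval x + (x - y) * (derivative (derivative Q)).eval x :=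
    fun x => by simp [hP]; ring
  have hcont : ContinuousOn (fun x : ℝ => 2 * (1 - x ^ 2) * (derivative P).eval x
      - (σ * x + q) * P.eval x) (Set.Icc y 1) := by fun_prop
  -- The function is positive at `y`, where `P` vanishes and `P' = Q > 0`, and negative at `1`,
  -- where the factor `1 - x^2` vanishes and `σ + q > 0`.
  obtain ⟨x, ⟨hx1, hx2⟩, hx⟩ := intermediate_value_Ioo' hy1.le hcont (show (0 : ℝ) ∈ _ by
    constructor
    · have := mul_pos (mul_pos hσq (sub_pos.2 hy1)) (pos 1 hy1.le)
      simp only [hP0]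
      linarith
    · have h1 : 0 < (1 - y) * (1 + y) := mul_pos (by linarith) (by linarith)
      have := mul_pos h1 (pos y le_rfl)
      simp only [hP0, hP1]
      nlinarith)
  refine ⟨x, hx1, hx2, ?_⟩
  have hQ := pos x hx1.le
  have hl := lag x
  have ho := hode x
  simp only [hP0, hP1, hP2] at hx ho
  set q0 := Q.eval x
  set q1 := (derivative Q).eval x
  set q2 := (derivative (derivative Q)).eval x
  set d := x - y
  set w := 1 - x ^ 2
  set g := σ * x + q
  have key : d ^ 2 * (4 * l * w - g ^ 2) * q0 ^ 2 - 4 * w ^ 2 * q0 ^ 2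
      = 4 * w ^ 2 * d ^ 2 * (q1 ^ 2 - q0 * q2) := by
    linear_combination (4 * w * d * q0) * ho - (2 * w * (q0 + d * q1) - g * d * q0) * hx
  have h2 : 0 ≤ 4 * w ^ 2 * d ^ 2 * (q1 ^ 2 - q0 * q2) := by positivity
  have h3 : 4 * w ^ 2 * q0 ^ 2 ≤ d ^ 2 * (4 * l * w - g ^ 2) * q0 ^ 2 := by linarith
  exact le_of_mul_le_mul_right h3 (by positivity)

/-! ### Estimates at the turning point -/

/-- A cubic instance of the inequality of arithmetic and geometric means. -/
theorem three_mul_le_add_two_mul {u w c : ℝ} (hu : 0 ≤ u) (hw : 0 ≤ w)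
    (h : c ^ 3 = u * w ^ 2) : 3 * c ≤ u + 2 * w := by
  by_contra! hlt
  have h1 : (u + 2 * w) ^ 3 < (3 * c) ^ 3 := pow_lt_pow_left₀ hlt (by positivity) (by norm_num)
  -- This product is `(u + 2 w)^3 - 27 u w^2`.
  have h2 : 0 ≤ (u - w) ^ 2 * (u + 8 * w) := by positivity
  nlinarith

/-- Trades the varying `√v = j` for the constant `√(u + v) = l`, at the cost of an error only if `m
> 0`. After clearing denominators, the case `m ≤ 0` needs only `j ≤ l`; for `m > 0` the hypothesis
on `T` reduces the claim to the triangle inequality `l ≤ i + j`. -/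
theorem div_lt_div_add_two_mul_max {i j l m T : ℝ} (hi : 0 < i) (hj : 0 < j) (hl : 0 < l)
    (hl2 : l ^ 2 = i ^ 2 + j ^ 2) (hT0 : 0 ≤ T) (hT : 2 * l ^ 2 * m ≤ T) :
    T / (l * i) < (T - 2 * m * i ^ 2 + i ^ 2 * j ^ 2) / (i * j) + 2 * max m 0 := by
  have hjl : j ≤ l := abs_le_of_sq_le_sq' (by nlinarith [sq_nonneg i]) hl.le |>.2
  have hlij : l ≤ i + j := abs_le_of_sq_le_sq' (by nlinarith [mul_pos hi hj]) (by positivity) |>.2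
  have hp : 0 < i ^ 2 * j ^ 2 * l := by positivity
  rw [div_add' _ _ _ (by positivity), div_lt_div_iff₀ (by positivity) (by positivity)]
  have h0 : 0 ≤ T * (l - j) := mul_nonneg hT0 (by linarith)
  suffices T * j < (T - 2 * m * i ^ 2 + i ^ 2 * j ^ 2 + 2 * max m 0 * (i * j)) * l by
    have := mul_lt_mul_of_pos_right this hi
    linarith
  rcases le_total m 0 with hm | hm
  · rw [max_eq_right hm]
    have : 0 ≤ -m * (i ^ 2 * l) := mul_nonneg (by linarith) (by positivity)
    linarith
  · rw [max_eq_left hm]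
    have h1 : 2 * l ^ 2 * m * (l - j) ≤ T * (l - j) := mul_le_mul_of_nonneg_right hT (by linarith)
    have h2 : 0 ≤ 2 * m * j * l * (i + j - l) := by
      have : 0 ≤ i + j - l := by linarith
      positivity
    have h3 : 2 * l ^ 2 * m * (l - j) - 2 * m * i ^ 2 * l + 2 * m * (i * j) * l
        = 2 * m * j * l * (i + j - l) := by
      linear_combination 2 * m * l * hl2
    linarith

/-- Here `δ` is the distance from the zero to `x`, and `T - 2 m u + u v` is `1 - x^2` expanded at
`y₂`. AM-GM is applied to `u` and two copies of `T / √(2 R u)`, whose product `T^2 / (2 R)` no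
longer depends on `u`. -/
theorem three_mul_rpow_lt {D R T m u v δ : ℝ} (hD0 : 0 < D) (hR0 : 0 < R) (hT0 : 0 ≤ T)
    (hTm : 2 * (u + v) * m ≤ T) (hu0 : 0 < u) (hv0 : 0 < v) (huvD : (u + v) * D = 2 * R)
    (hδ : 0 < δ) (h : 4 * (T - 2 * m * u + u * v) ^ 2 ≤ δ ^ 2 * (D * u * v)) :
    3 * (T ^ (2 / 3 : ℝ) * (2 * R) ^ (-(1 / 3) : ℝ)) < u + δ + 2 / √D * (2 * max m 0) := by
  have hc3 : (T ^ (2 / 3 : ℝ) * (2 * R) ^ (-(1 / 3) : ℝ)) ^ 3 = T ^ 2 / (2 * R) := by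
    rw [mul_pow, ← Real.rpow_natCast, ← Real.rpow_natCast, ← Real.rpow_mul hT0,
      ← Real.rpow_mul (by positivity)]
    norm_num [Real.rpow_neg_one]
    ring
  have hsum : 0 < u + v := by linarith
  generalize T ^ (2 / 3 : ℝ) * (2 * R) ^ (-(1 / 3) : ℝ) = c at *
  obtain ⟨i, hi, rfl⟩ : ∃ i, 0 < i ∧ u = i ^ 2 :=
    ⟨√u, Real.sqrt_pos.2 hu0, (Real.sq_sqrt hu0.le).symm⟩
  obtain ⟨j, hj, rfl⟩ : ∃ j, 0 < j ∧ v = j ^ 2 :=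
    ⟨√v, Real.sqrt_pos.2 hv0, (Real.sq_sqrt hv0.le).symm⟩
  obtain ⟨l, hl, hl2⟩ : ∃ l, 0 < l ∧ i ^ 2 + j ^ 2 = l ^ 2 :=
    ⟨√(i ^ 2 + j ^ 2), Real.sqrt_pos.2 hsum, (Real.sq_sqrt hsum.le).symm⟩
  obtain ⟨d, hd, hd2⟩ : ∃ d, 0 < d ∧ √D = d := ⟨_, Real.sqrt_pos.2 hD0, rfl⟩
  have hDd : D = d ^ 2 := by rw [← hd2, Real.sq_sqrt hD0.le]
  rw [hl2] at huvD hTm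
  rw [hd2]
  have hmain := div_lt_div_add_two_mul_max hi hj hl hl2.symm hT0 hTm
  have hroot : 2 * (T - 2 * m * i ^ 2 + i ^ 2 * j ^ 2) ≤ δ * (d * i * j) := by
    refine abs_le_of_sq_le_sq' ?_ (by positivity) |>.2
    rw [hDd] at h
    linarith
  have hamgm : 3 * c ≤ i ^ 2 + 2 * (T / (d * l * i)) := by
    refine three_mul_le_add_two_mul (by positivity) (by positivity) ?_
    rw [hc3, ← huvD, hDd]
    field_simp
  have hdiv : 2 / d * ((T - 2 * m * i ^ 2 + i ^ 2 * j ^ 2) / (i * j)) ≤ δ := by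
    rw [div_mul_div_comm, div_le_iff₀ (by positivity)]
    linarith
  have hlt := mul_lt_mul_of_pos_left hmain (show 0 < 2 / d by positivity)
  have e3 : 2 / d * (T / (l * i)) = 2 * (T / (d * l * i)) := by field_simp
  rw [e3, mul_add] at hlt
  linarith

/-- The quantitative step: a lower bound for the distance from `z` to the right turning point. -/
theorem lt_turning_point_sub {N D σ q R x z y₁ y₂ : ℝ} (hN : 0 < N) (hσ : 0 < σ)
    (hD : D = N + σ ^ 2) (hM : 0 < D - q ^ 2) (hR : R = Real.sqrt ((D - q ^ 2) * N))
    (hy₁ : y₁ = -((R + q * σ) / D)) (hy₂ : y₂ = (R - q * σ) / D)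
    (hzx : z < x) (hx : 0 < 1 - x ^ 2)
    (h : 4 * (1 - x ^ 2) ^ 2 ≤ (x - z) ^ 2 * (N * (1 - x ^ 2) - (σ * x + q) ^ 2)) :
    z < y₂ - 3 * (1 - y₂ ^ 2) ^ (2 / 3 : ℝ) * (2 * R) ^ (-(1 / 3) : ℝ)
        + 4 * max (q * σ) 0 / D ^ (3 / 2 : ℝ) := by
  have hD0 : 0 < D := by rw [hD]; positivity
  have hR0 : 0 < R := by rw [hR]; exact Real.sqrt_pos.2 (mul_pos hM hN)
  have hR2 : R ^ 2 = (D - q ^ 2) * N := by rw [hR]; exact Real.sq_sqrt (mul_pos hM hN).le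
  have hN' : N = D - σ ^ 2 := by linarith
  set m := q * σ / D with hm
  have hmD : m * D = q * σ := by rw [hm]; field_simp
  set u := y₂ - x with hu
  set v := x - y₁ with hv
  have huv : u + v = 2 * R / D := by rw [hu, hv, hy₁, hy₂]; field_simp; ring
  have huvD : (u + v) * D = 2 * R := by rw [huv]; field_simp
  have hDy₁ : D * y₁ = -(R + q * σ) := by rw [hy₁]; field_simp
  have hDy₂ : D * y₂ = R - q * σ := by rw [hy₂]; field_simp
  -- `y₁` and `y₂` are the roots of this quadratic, whose leading coefficient is `-D`.
  have hquad : N * (1 - x ^ 2) - (σ * x + q) ^ 2 = D * u * v := by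
    have : D * (N * (1 - x ^ 2) - (σ * x + q) ^ 2) = D * (D * u * v) := by
      have e : D * (D * u * v) = (D * y₂ - D * x) * (D * x - D * y₁) := by rw [hu, hv]; ring
      rw [e, hDy₁, hDy₂]
      have : (R - q * σ - D * x) * (D * x - -(R + q * σ)) = R ^ 2 - (D * x + q * σ) ^ 2 := by ring
      rw [this, hR2, hN']; ring
    exact mul_left_cancel₀ hD0.ne' this
  rw [hquad] at h
  have hprod : 0 < D * u * v := by
    by_contra hneg
    have : (x - z) ^ 2 * (D * u * v) ≤ 0 :=
      mul_nonpos_of_nonneg_of_nonpos (sq_nonneg _) (not_lt.1 hneg)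
    have : 0 < 4 * (1 - x ^ 2) ^ 2 := by positivity
    linarith
  have huv0 : 0 < u * v := by
    rw [mul_assoc] at hprod
    exact pos_of_mul_pos_right hprod hD0.le
  have hsum : 0 < u + v := by rw [huv]; positivity
  have hu0 : 0 < u := by
    rcases pos_and_pos_or_neg_and_neg_of_mul_pos huv0 with h' | h' <;> linarith [h'.1, h'.2]
  have hv0 : 0 < v := pos_of_mul_pos_right huv0 hu0.le
  have hDq : 0 ≤ D - q * σ := by linarith [sq_nonneg (q - σ)]
  have hDq' : 0 ≤ D + q * σ := by linarith [sq_nonneg (q + σ)]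
  -- `(D - q σ)^2 - R^2 = D (q - σ)^2`; this and its mirror image place both turning points in `[-1,
  -- 1]`.
  have hRle : R ≤ D - q * σ := abs_le_of_sq_le_sq' (by
    rw [hR2, hN']; linarith [mul_nonneg hD0.le (sq_nonneg (q - σ))]) hDq |>.2
  have hRle' : R ≤ D + q * σ := abs_le_of_sq_le_sq' (by
    rw [hR2, hN']; linarith [mul_nonneg hD0.le (sq_nonneg (q + σ))]) hDq' |>.2
  set T := 1 - y₂ ^ 2 with hT
  have hy₂m : y₂ = (u + v) / 2 - m := by rw [huv, hy₂, hm]; field_simp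
  have hρm : (u + v) / 2 + m ≤ 1 := by
    have : ((u + v) / 2 + m) * D ≤ 1 * D := by linarith
    exact le_of_mul_le_mul_right this hD0
  have hy₂1 : y₂ ≤ 1 := by
    have : D * y₂ ≤ D * 1 := by linarith
    exact le_of_mul_le_mul_left this hD0
  have hy₂1' : -1 ≤ y₂ := by
    have : D * (-1) ≤ D * y₂ := by linarith
    exact le_of_mul_le_mul_left this hD0
  have hT0 : 0 ≤ T := by
    linarith [mul_nonneg (sub_nonneg.2 hy₂1) (neg_le_iff_add_nonneg.1 hy₂1')]
  have hw : 1 - x ^ 2 = T - 2 * m * u + u * v := by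
    have : x = y₂ - u := by rw [hu]; ring
    rw [this, hT, hy₂m]; ring
  -- Since `(u + v) / 2 + m = -y₁`, the difference of the two sides is `1 - y₁^2`.
  have hTm : 2 * (u + v) * m ≤ T := by
    have : -1 ≤ (u + v) / 2 + m := by
      have : (-1) * D ≤ ((u + v) / 2 + m) * D := by linarith
      exact le_of_mul_le_mul_right this hD0
    rw [hT, hy₂m]
    linarith [mul_nonneg (sub_nonneg.2 hρm) (neg_le_iff_add_nonneg.1 this)]
  have hmax : 4 * max (q * σ) 0 / D ^ (3 / 2 : ℝ) = 2 / √D * (2 * max m 0) := by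
    have e1 : D ^ (3 / 2 : ℝ) = D * √D := by
      rw [Real.sqrt_eq_rpow, ← Real.rpow_one_add' hD0.le (by norm_num)]; norm_num
    have e2 : max (q * σ) 0 = max m 0 * D := by
      rw [max_mul_of_nonneg _ _ hD0.le, hmD, zero_mul]
    have := Real.sqrt_pos.2 hD0
    rw [e1, e2]; field_simp; ring
  rw [hw] at h
  rw [hmax, mul_assoc]
  have := three_mul_rpow_lt hD0 hR0 hT0 hTm hu0 hv0 huvD (sub_pos.2 hzx) h
  linarith

/-! ### The Jacobi weight and the differential equation -/

section JacobiPolynomial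

open MeasureTheory Set Polynomial

/-- On each side of `0` only one factor can be singular; the other is continuous there. -/
theorem intervalIntegrable_jacobiWeight {α β : ℝ} (hα : -1 < α) (hβ : -1 < β) :
    IntervalIntegrable (jacobiWeight α β) volume (-1) 1 := by
  have hl : IntervalIntegrable (jacobiWeight α β) volume (-1) 0 := by
    have h1 : IntervalIntegrable (fun x : ℝ => (1 + x) ^ β) volume (-1) 0 := by
      have := (intervalIntegral.intervalIntegrable_rpow' (a := 0) (b := 1) hβ).comp_add_left 1
      simpa using this
    refine h1.continuousOn_mul (f := fun x : ℝ => (1 + x) ^ β) (g := fun x : ℝ => (1 - x) ^ α) ?_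
    refine ContinuousOn.rpow_const (by fun_prop) fun x hx => Or.inl ?_
    rw [uIcc_of_le (by norm_num)] at hx
    linarith [hx.2]
  have hr : IntervalIntegrable (jacobiWeight α β) volume 0 1 := by
    have h1 : IntervalIntegrable (fun x : ℝ => (1 - x) ^ α) volume 0 1 := by
      have := (intervalIntegral.intervalIntegrable_rpow' (a := 0) (b := 1) hα).comp_sub_left 1
      simpa using this.symm
    refine h1.mul_continuousOn (f := fun x : ℝ => (1 - x) ^ α) (g := fun x : ℝ => (1 + x) ^ β) ?_
    refine ContinuousOn.rpow_const (by fun_prop) fun x hx => Or.inl ?_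
    rw [uIcc_of_le (by norm_num)] at hx
    linarith [hx.1]
  exact hl.trans hr

theorem intervalIntegrable_eval_mul_jacobiWeight {α β : ℝ} (hα : -1 < α) (hβ : -1 < β)
    (G : ℝ[X]) :
    IntervalIntegrable (fun x => G.eval x * jacobiWeight α β x) volume (-1) 1 :=
  (intervalIntegrable_jacobiWeight hα hβ).continuousOn_mul (by fun_prop)

theorem jacobiWeight_pos {α β x : ℝ} (hx : x ∈ Ioo (-1 : ℝ) 1) : 0 < jacobiWeight α β x :=
  mul_pos (Real.rpow_pos_of_pos (by linarith [hx.2]) _)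
    (Real.rpow_pos_of_pos (by linarith [hx.1]) _)

theorem eq_zero_of_integral_mul_jacobiWeight_eq_zero {α β : ℝ} (hα : -1 < α) (hβ : -1 < β)
    {G : ℝ[X]} (hG : ∀ x ∈ Ioo (-1 : ℝ) 1, 0 ≤ G.eval x)
    (h : ∫ x in (-1 : ℝ)..1, G.eval x * jacobiWeight α β x = 0) : G = 0 := by
  by_contra hne
  refine absurd h (ne_of_gt ?_)
  have hnn : ∀ x ∈ Ioo (-1 : ℝ) 1, 0 ≤ G.eval x * jacobiWeight α β x := fun x hx =>
    mul_nonneg (hG x hx) (jacobiWeight_pos hx).le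
  rw [intervalIntegral.integral_of_le (by norm_num), integral_Ioc_eq_integral_Ioo]
  have hint := (intervalIntegrable_iff_integrableOn_Ioo_of_le (by norm_num)).1
    (intervalIntegrable_eval_mul_jacobiWeight hα hβ G)
  rw [setIntegral_pos_iff_support_of_nonneg_ae
    ((ae_restrict_iff' measurableSet_Ioo).2 (Filter.Eventually.of_forall hnn)) hint]
  have hsub : Ioo (-1 : ℝ) 1 \ {x | G.IsRoot x} ⊆
      Function.support (fun x => G.eval x * jacobiWeight α β x) ∩ Ioo (-1 : ℝ) 1 :=
    fun x hx => ⟨mul_ne_zero hx.2 (jacobiWeight_pos hx.1).ne', hx.1⟩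
  refine lt_of_lt_of_le ?_ (measure_mono hsub)
  rw [measure_sdiff_null ((Polynomial.finite_setOfPred_isRoot hne).measure_zero _)]
  simp

/-- The integrand is the derivative of `(1 - x)^(α + 1) (1 + x)^(β + 1) G`, which vanishes at both
endpoints because the exponents are positive. -/
theorem integral_derivative_mul_jacobiWeight {α β : ℝ} (hα : -1 < α) (hβ : -1 < β) (G : ℝ[X]) :
    ∫ x in (-1 : ℝ)..1, ((1 - X ^ 2) * derivative G
      - (C (α + β + 2) * X + C (α - β)) * G).eval x * jacobiWeight α β x = 0 := by
  have hcont : ContinuousOn (fun x : ℝ => (1 - x) ^ (α + 1) * (1 + x) ^ (β + 1) * G.eval x)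
      (Icc (-1) 1) := by
    refine (ContinuousOn.mul ?_ ?_).mul (by fun_prop)
    · exact ContinuousOn.rpow_const (by fun_prop) fun x _ => Or.inr (by linarith)
    · exact ContinuousOn.rpow_const (by fun_prop) fun x _ => Or.inr (by linarith)
  rw [intervalIntegral.integral_eq_sub_of_hasDerivAt_of_le (by norm_num) hcont (fun x hx => ?_)
    (intervalIntegrable_eval_mul_jacobiWeight hα hβ _)]
  · have h1 : (0 : ℝ) ^ (α + 1) = 0 := Real.zero_rpow (by linarith)
    have h2 : (0 : ℝ) ^ (β + 1) = 0 := Real.zero_rpow (by linarith)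
    norm_num [h1, h2]
  · have hx1 : 0 < 1 - x := by linarith [hx.2]
    have hx2 : 0 < 1 + x := by linarith [hx.1]
    have d1 := ((hasDerivAt_id x).const_sub 1).rpow_const (p := α + 1) (Or.inl hx1.ne')
    have d2 := ((hasDerivAt_id x).const_add 1).rpow_const (p := β + 1) (Or.inl hx2.ne')
    refine ((d1.mul d2).mul (G.hasDerivAt x)).congr_deriv ?_
    simp only [id, add_sub_cancel_right, jacobiWeight, Real.rpow_add_one hx1.ne',
      Real.rpow_add_one hx2.ne', eval_sub, eval_mul, eval_add, eval_one, eval_pow, eval_X, eval_C,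
      Pi.mul_apply]
    ring

theorem IsJacobiPolynomial.ne_zero {α β : ℝ} {k : ℕ} {P : ℝ[X]}
    (hP : IsJacobiPolynomial α β k P) : P ≠ 0 := by
  rintro rfl
  simpa using hP.degree_eq

/-- Integration by parts: the Jacobi differential operator is symmetric. -/
theorem integral_jacobiOperator_mul {α β : ℝ} (hα : -1 < α) (hβ : -1 < β) (P Q : ℝ[X]) :
    ∫ x in (-1 : ℝ)..1, ((1 - X ^ 2) * derivative (derivative P)
        - (C (α + β + 2) * X + C (α - β)) * derivative P).eval x * Q.eval x * jacobiWeight α β x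
      = ∫ x in (-1 : ℝ)..1, P.eval x * ((1 - X ^ 2) * derivative (derivative Q)
        - (C (α + β + 2) * X + C (α - β)) * derivative Q).eval x * jacobiWeight α β x := by
  -- For this Wronskian the terms in `P' Q'` cancel, leaving the difference of the two integrands.
  have h := integral_derivative_mul_jacobiWeight hα hβ (derivative P * Q - P * derivative Q)
  rw [← sub_eq_zero, ← intervalIntegral.integral_sub, ← h]
  · refine intervalIntegral.integral_congr fun x _ => ?_
    simp only [eval_mul, eval_sub, eval_add, derivative_mul, derivative_sub]
    ring
  · simpa only [← eval_mul] using intervalIntegrable_eval_mul_jacobiWeight hα hβ _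
  · simpa only [← eval_mul] using intervalIntegrable_eval_mul_jacobiWeight hα hβ _

theorem natDegree_jacobiOperator_le (a b : ℝ) {n : ℕ} {Q : ℝ[X]} (hQ : Q.natDegree ≤ n) :
    ((1 - X ^ 2) * derivative (derivative Q) - (C a * X + C b) * derivative Q).natDegree ≤ n := by
  rw [natDegree_le_iff_coeff_eq_zero] at hQ ⊢
  intro N hN
  obtain ⟨M, rfl⟩ : ∃ M, N = M + 1 := ⟨N - 1, by omega⟩
  have h1 := hQ (M + 1) hN
  have h2 := hQ (M + 2) (by omega)
  have h3 := hQ (M + 3) (by omega)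
  rcases M with _ | M <;>
  simp [sub_mul, add_mul, mul_assoc, coeff_derivative, coeff_X_pow_mul', coeff_X_mul, h1, h2, h3]

theorem coeff_jacobiOperator (a b : ℝ) {n : ℕ} {Q : ℝ[X]} (hQ : Q.natDegree ≤ n) :
    ((1 - X ^ 2) * derivative (derivative Q) - (C a * X + C b) * derivative Q).coeff n
      = -(n * (n - 1 + a)) * Q.coeff n := by
  rw [natDegree_le_iff_coeff_eq_zero] at hQ
  have h1 := hQ (n + 1) (by omega)
  have h2 := hQ (n + 2) (by omega)
  rcases n with _ | _ | M <;>
  simp [sub_mul, add_mul, mul_assoc, coeff_derivative, coeff_X_pow_mul', coeff_X_mul, h1, h2]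
  all_goals ring

/-- The Jacobi differential equation. -/
theorem IsJacobiPolynomial.differential_equation {α β : ℝ} {k : ℕ} {P : ℝ[X]}
    (hα : -1 < α) (hβ : -1 < β) (hP : IsJacobiPolynomial α β k P) :
    (1 - X ^ 2) * derivative (derivative P) - (C (α + β + 2) * X + C (α - β)) * derivative P
      + C (k * (k + α + β + 1) : ℝ) * P = 0 := by
  have hnat : P.natDegree = k := natDegree_eq_of_degree_eq_some hP.degree_eq
  set T : ℝ[X] → ℝ[X] := fun Q =>
    (1 - X ^ 2) * derivative (derivative Q) - (C (α + β + 2) * X + C (α - β)) * derivative Q with hT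
  set G : ℝ[X] := T P + C (k * (k + α + β + 1) : ℝ) * P with hG
  -- The constant `k (k + α + β + 1)` is chosen to cancel the coefficient of `x^k`.
  have hGdeg : G.degree < k := by
    rw [degree_lt_iff_coeff_zero]
    intro n hn
    have hPn : n ≠ k → P.coeff n = 0 := fun h => coeff_eq_zero_of_natDegree_lt (by omega)
    rw [hG, coeff_add, coeff_C_mul]
    rw [show (T P).coeff n = -(n * (n - 1 + (α + β + 2))) * P.coeff n from
      coeff_jacobiOperator _ _ (by omega)]
    rcases eq_or_ne n k with rfl | h
    · ring
    · simp [hPn h]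
  have hTG : (T G).degree < k := by
    by_cases h0 : G = 0
    · simp [h0, hT]
    · have h1 : G.natDegree < k := (natDegree_lt_iff_degree_lt h0).2 hGdeg
      exact (degree_le_of_natDegree_le (natDegree_jacobiOperator_le _ _ le_rfl)).trans_lt
        (by exact_mod_cast h1)
  -- By symmetry of the operator, `∫ G^2` against the weight splits into integrals of `P` against `T
  -- G` and `G`, both of degree less than `k`. So it vanishes, and `G = 0`.
  refine eq_zero_of_integral_mul_jacobiWeight_eq_zero (G := G * G) hα hβ
    (fun x _ => by rw [eval_mul]; exact mul_self_nonneg _) ?_ |> mul_self_eq_zero.1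
  have e : ∀ x, (G * G).eval x * jacobiWeight α β x
      = (T P).eval x * G.eval x * jacobiWeight α β x
        + (k * (k + α + β + 1)) * (P.eval x * G.eval x * jacobiWeight α β x) := fun x => by
    rw [eval_mul]
    nth_rewrite 1 [hG]
    rw [eval_add, eval_mul, eval_C]
    ring
  simp_rw [e]
  rw [intervalIntegral.integral_add, intervalIntegral.integral_const_mul, hP.orthogonal G hGdeg,
    integral_jacobiOperator_mul hα hβ, hP.orthogonal _ hTG]
  · simp
  · simpa only [← eval_mul] using intervalIntegrable_eval_mul_jacobiWeight hα hβ (T P * G)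
  · simpa only [← eval_mul] using
      (intervalIntegrable_eval_mul_jacobiWeight hα hβ (P * G)).const_mul _

/-! ### Location of the zeros -/

/-- Multiplying a polynomial by the linear factors at its sign changes in an interval gives a
polynomial of constant sign there. -/
theorem exists_finset_roots_constant_sign {a b : ℝ} (n : ℕ) (P : ℝ[X]) (hn : P.natDegree = n)
    (hP : P ≠ 0) :
    ∃ Z : Finset ℝ, (∀ z ∈ Z, z ∈ Ioo a b ∧ P.IsRoot z) ∧
      ((∀ x ∈ Ioo a b, 0 ≤ (P * ∏ z ∈ Z, (X - C z)).eval x) ∨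
        ∀ x ∈ Ioo a b, (P * ∏ z ∈ Z, (X - C z)).eval x ≤ 0) := by
  classical
  induction n generalizing P with
  | zero =>
    refine ⟨∅, by simp, ?_⟩
    rw [eq_C_of_natDegree_eq_zero hn]
    simpa using (le_total 0 (P.coeff 0)).imp (fun h _ _ _ => h) (fun h _ _ _ => h)
  | succ n ih =>
    by_cases hroot : ∃ z ∈ Ioo a b, P.IsRoot z
    · obtain ⟨z, hz, hPz⟩ := hroot
      obtain ⟨P₁, rfl⟩ := dvd_iff_isRoot.2 hPz
      have hP₁ : P₁ ≠ 0 := right_ne_zero_of_mul hP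
      rw [natDegree_mul (X_sub_C_ne_zero z) hP₁, natDegree_X_sub_C] at hn
      obtain ⟨Z, hZ, hsign⟩ := ih P₁ (by omega) hP₁
      -- `Z` collects the zeros of odd multiplicity, so one more factor `X - C z` toggles the
      -- membership of `z`.
      by_cases hzZ : z ∈ Z
      · refine ⟨Z.erase z, fun y hy => ?_, ?_⟩
        · have := hZ y (Finset.mem_of_mem_erase hy)
          exact ⟨this.1, root_mul_left_of_isRoot _ this.2⟩
        · have : (X - C z) * P₁ * ∏ y ∈ Z.erase z, (X - C y) = P₁ * ∏ y ∈ Z, (X - C y) := by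
            rw [← Finset.mul_prod_erase Z _ hzZ]; ring
          rwa [this]
      · refine ⟨insert z Z, fun y hy => ?_, ?_⟩
        · rcases Finset.mem_insert.1 hy with rfl | hy
          · exact ⟨hz, hPz⟩
          · exact ⟨(hZ y hy).1, root_mul_left_of_isRoot _ (hZ y hy).2⟩
        · have : (X - C z) * P₁ * ∏ y ∈ insert z Z, (X - C y)
              = (X - C z) ^ 2 * (P₁ * ∏ y ∈ Z, (X - C y)) := by
            rw [Finset.prod_insert hzZ]; ring
          simp only [this, eval_mul (p := (X - C z) ^ 2), eval_pow]
          exact hsign.imp (fun h x hx => mul_nonneg (sq_nonneg _) (h x hx))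
            (fun h x hx => mul_nonpos_of_nonneg_of_nonpos (sq_nonneg _) (h x hx))
    · push Not at hroot
      refine ⟨∅, by simp, ?_⟩
      by_contra! hcon
      obtain ⟨⟨x, hx, hx0⟩, y, hy, hy0⟩ := hcon
      simp only [Finset.prod_empty, mul_one] at hx0 hy0
      obtain ⟨z, hz, hz0⟩ := isPreconnected_Ioo.intermediate_value hx hy
        P.continuous.continuousOn ⟨hx0.le, hy0.le⟩
      exact hroot z hz hz0

/-- With fewer than `k` sign changes, the product of their linear factors would be orthogonal to
`P`, although its product with `P` has constant sign. Hence there are `k` distinct zeros in the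
interval, which exhausts the degree. -/
theorem IsJacobiPolynomial.exists_eq_prod {α β : ℝ} {k : ℕ} {P : ℝ[X]}
    (hα : -1 < α) (hβ : -1 < β) (hP : IsJacobiPolynomial α β k P) :
    ∃ Z : Finset ℝ, Z.card = k ∧ (∀ z ∈ Z, z ∈ Ioo (-1 : ℝ) 1) ∧
      P = C P.leadingCoeff * ∏ z ∈ Z, (X - C z) := by
  have hnat : P.natDegree = k := natDegree_eq_of_degree_eq_some hP.degree_eq
  obtain ⟨Z, hZ, hsign⟩ := exists_finset_roots_constant_sign (a := -1) (b := 1) _ P hnat hP.ne_zero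
  have hmonic : (∏ z ∈ Z, (X - C z)).Monic := monic_prod_X_sub_C _ _
  have hne : P * ∏ z ∈ Z, (X - C z) ≠ 0 := mul_ne_zero hP.ne_zero hmonic.ne_zero
  have hle : k ≤ Z.card := by
    by_contra! hlt
    have h0 : ∫ x in (-1 : ℝ)..1, (P * ∏ z ∈ Z, (X - C z)).eval x * jacobiWeight α β x = 0 := by
      simp_rw [eval_mul]
      refine hP.orthogonal _ ?_
      rw [degree_prod]
      simpa using hlt
    rcases hsign with h | h
    · exact hne (eq_zero_of_integral_mul_jacobiWeight_eq_zero hα hβ h h0)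
    · refine neg_ne_zero.2 hne (eq_zero_of_integral_mul_jacobiWeight_eq_zero hα hβ
        (fun x hx => by rw [eval_neg]; linarith [h x hx]) ?_)
      simp only [eval_neg, neg_mul, intervalIntegral.integral_neg, h0, neg_zero]
  have hsub : Z.val ≤ P.roots :=
    Multiset.le_iff_subset Z.nodup |>.2 fun z hz => (mem_roots hP.ne_zero).2 (hZ z hz).2
  have hcard := P.card_roots'
  have heq : Z.val = P.roots := Multiset.eq_of_le_of_card_le hsub (by
    rw [Finset.card_val]; omega)
  have hroots : P.roots.card = P.natDegree := by
    have : Z.card = P.roots.card := by rw [← heq, Finset.card_val]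
    omega
  refine ⟨Z, ?_, fun z hz => (hZ z hz).1, ?_⟩
  · rw [← Finset.card_val, heq, hroots, hnat]
  · conv_lhs => rw [← C_leadingCoeff_mul_prod_multiset_X_sub_C hroots, ← heq]
    rfl

/-! ### Reflection and the bounds for the extreme zeros -/

theorem IsJacobiPolynomial.comp_neg_X {α β : ℝ} {k : ℕ} {P : ℝ[X]}
    (hP : IsJacobiPolynomial α β k P) : IsJacobiPolynomial β α k (P.comp (-X)) := by
  refine ⟨by rw [degree_comp_neg_X, hP.degree_eq], fun Q hQ => ?_⟩
  have h := hP.orthogonal (Q.comp (-X)) (by rwa [degree_comp_neg_X])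
  have h2 := intervalIntegral.integral_comp_neg (a := -1) (b := 1)
    (fun x => P.eval x * (Q.comp (-X)).eval x * jacobiWeight α β x)
  rw [neg_neg, h] at h2
  rw [← h2]
  refine intervalIntegral.integral_congr fun x _ => ?_
  simp only [eval_comp, eval_neg, eval_X, neg_neg, jacobiWeight, sub_neg_eq_add, ← sub_eq_add_neg]
  ring

/-- The upper bound for the largest zero, for either order of the parameters. -/
theorem IsJacobiPolynomial.exists_isGreatest_isRoot_lt {α β : ℝ} {k : ℕ} {P : ℝ[X]}
    (hk : 1 ≤ k) (hα : -1 < α) (hβ : -1 < β) (hP : IsJacobiPolynomial α β k P)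
    {s q r R y : ℝ} (hs : s = α + β + 1) (hq : q = α - β) (hr : r = 2 * (k : ℝ) + α + β + 1)
    (hR : R = Real.sqrt ((r ^ 2 - q ^ 2 + 2 * s + 1) * (r ^ 2 - s ^ 2)))
    (hy : y = (R - q * (s + 1)) / (r ^ 2 + 2 * s + 1)) :
    ∃ xM : ℝ, IsGreatest {x : ℝ | P.IsRoot x} xM ∧
      xM < y - 3 * (1 - y ^ 2) ^ (2 / 3 : ℝ) * (2 * R) ^ (-(1 / 3) : ℝ)
        + 4 * max (q * (s + 1)) 0 / (r ^ 2 + 2 * s + 1) ^ (3 / 2 : ℝ) := by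
  classical
  obtain ⟨Z, hcard, hZ, hfac⟩ := hP.exists_eq_prod hα hβ
  have hlead : P.leadingCoeff ≠ 0 := leadingCoeff_ne_zero.2 hP.ne_zero
  have hroot : ∀ x, P.IsRoot x ↔ x ∈ Z := fun x => by
    rw [hfac, IsRoot.def, eval_mul, eval_C, mul_eq_zero, or_iff_right hlead, eval_prod,
      Finset.prod_eq_zero_iff]
    simp [sub_eq_zero]
  have hne : Z.Nonempty := Finset.card_pos.1 (by omega)
  set z := Z.max' hne with hz
  have hzZ : z ∈ Z := Z.max'_mem hne
  refine ⟨z, ⟨(hroot z).2 hzZ, fun x hx => Z.le_max' x ((hroot x).1 hx)⟩, ?_⟩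
  set P₀ : ℝ[X] := (X - C z) * ∏ y ∈ Z.erase z, (X - C y) with hP₀
  have hPP₀ : P = C P.leadingCoeff * P₀ := by
    rwa [hP₀, Finset.mul_prod_erase Z (fun y => X - C y) hzZ]
  have hode : ∀ x : ℝ, (1 - x ^ 2) * (derivative (derivative P₀)).eval x
      - ((α + β + 2) * x + (α - β)) * (derivative P₀).eval x
      + (k * (k + α + β + 1)) * P₀.eval x = 0 := fun x => by
    have h := congrArg (eval x) (hP.differential_equation hα hβ)
    rw [hPP₀] at h
    simp only [derivative_mul, derivative_C, zero_mul, zero_add, eval_add, eval_sub, eval_mul,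
      eval_one, eval_pow, eval_X, eval_C, eval_zero] at h
    refine (mul_eq_zero.1 (?_ : P.leadingCoeff * _ = 0)).resolve_left hlead
    linarith
  obtain ⟨x, hzx, hx1, hx⟩ := exists_discriminant_ge_of_jacobi_equation
    (show 0 < (α + β + 2) + (α - β) by linarith) (hZ z hzZ).1 (hZ z hzZ).2
    (fun y hy => lt_of_le_of_ne (Z.le_max' y (Finset.mem_of_mem_erase hy))
      (Finset.ne_of_mem_erase hy)) hode
  have hk' : (1 : ℝ) ≤ k := by exact_mod_cast hk
  have hN : r ^ 2 - s ^ 2 = 4 * (k * (k + α + β + 1)) := by rw [hr, hs]; ring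
  have hNpos : 0 < r ^ 2 - s ^ 2 := by
    have : 0 < (k : ℝ) + α + β + 1 := by linarith
    rw [hN]; positivity
  refine lt_turning_point_sub (N := r ^ 2 - s ^ 2) (D := r ^ 2 + 2 * s + 1) (σ := s + 1) (q := q)
    (x := x) hNpos (by linarith) (by ring) ?_ (by rw [hR]; congr 2; ring) rfl hy hzx ?_ ?_
  -- `D - q^2` is `r^2 - s^2` plus `(s + 1)^2 - q^2 = 4 (α + 1) (β + 1)`.
  · have h1 : 0 < (α + 1) * (β + 1) := mul_pos (by linarith) (by linarith)
    have h2 : (s + 1) ^ 2 - q ^ 2 = 4 * ((α + 1) * (β + 1)) := by rw [hs, hq]; ring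
    linarith
  · have := mul_pos (sub_pos.2 hx1) (show 0 < 1 + x by linarith [(hZ z hzZ).1])
    linarith
  · rw [hN, show s + 1 = α + β + 2 by rw [hs]; ring, hq]
    exact hx

end JacobiPolynomial

theorem theorem7 (k : ℕ) (hk : 1 ≤ k) (α β : ℝ) (hαβ : β ≤ α) (hβ : -1 < β)
    (P : Polynomial ℝ) (hP : IsJacobiPolynomial α β k P)
    (s q r R y₁ y₂ : ℝ)
    (hs : s = α + β + 1) (hq : q = α - β) (hr : r = 2 * (k : ℝ) + α + β + 1)
    (hR : R = Real.sqrt ((r ^ 2 - q ^ 2 + 2 * s + 1) * (r ^ 2 - s ^ 2)))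
    (hy₁ : y₁ = -((R + q * (s + 1)) / (r ^ 2 + 2 * s + 1)))
    (hy₂ : y₂ = (R - q * (s + 1)) / (r ^ 2 + 2 * s + 1)) :
    ∃ xm xM : ℝ,
      IsLeast {x : ℝ | P.IsRoot x} xm ∧
      IsGreatest {x : ℝ | P.IsRoot x} xM ∧
      y₁ + 3 * (1 - y₁ ^ 2) ^ (2 / 3 : ℝ) * (2 * R) ^ (-(1 / 3) : ℝ) < xm ∧
      xM < y₂ - 3 * (1 - y₂ ^ 2) ^ (2 / 3 : ℝ) * (2 * R) ^ (-(1 / 3) : ℝ)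
        + 4 * q * (s + 1) / (r ^ 2 + 2 * s + 1) ^ (3 / 2 : ℝ) := by
  have hα : -1 < α := hβ.trans_le hαβ
  have hqs : 0 ≤ q * (s + 1) := mul_nonneg (by linarith) (by linarith)
  obtain ⟨xM, hxM, hM⟩ := hP.exists_isGreatest_isRoot_lt hk hα hβ hs hq hr hR hy₂
  -- Swapping the parameters negates `q` and preserves `s`, `r` and `R`, so the right turning point
  -- of the reflected polynomial is `-y₁`.
  obtain ⟨x, hx, hm⟩ := hP.comp_neg_X.exists_isGreatest_isRoot_lt hk hβ hα (s := s) (q := -q)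
    (r := r) (R := R) (y := -y₁) (by linarith) (by linarith) (by linarith)
    (by rw [neg_sq]; exact hR) (by rw [hy₁]; ring)
  have hmax : max (-q * (s + 1)) 0 = 0 := max_eq_right (by linarith)
  rw [max_eq_left hqs, ← mul_assoc] at hM
  rw [hmax, neg_sq, mul_zero, zero_div, add_zero] at hm
  refine ⟨-x, xM, ⟨?_, fun y hy => ?_⟩, hxM, by linarith, hM⟩
  · simpa [Polynomial.IsRoot] using hx.1
  · have : -y ≤ x := hx.2 (by simpa [Polynomial.IsRoot] using hy)
    linarith
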